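/- For $\lambda \in \mathbb{C} \setminus \{0,1\}$ let $E_\lambda \colon y^2 = x(x-1)(x-\lambda)$ be the Legendre elliptic curve over $\mathbb{C}$. For $\alpha \in \mathbb{C} \setminus \{0,1\}$ let $T(\alpha)$ be the set of all $\lambda \in \mathbb{C} \setminus \{0,1\}$ such that a point with $x$-coordinate $\alpha$ on $E_\lambda$ is a torsion point, and set $T(\alpha,\beta) = T(\alpha) \cap T(\beta)$. Let $v$ be the $2$-adic valuation on $\mathbb{Q}$, normalized by $v(2) = 1$, and let $\rho \colon \mathbb{Q} \to \mathbb{P}^1(\mathbb{F}_2)$ be reduction mod $2$, sending a fraction $m/n$ in lowest terms to $(m \bmod 2 : n \bmod 2)$. For rational numbers, $a \equiv b \bmod 4$ means $a - b \in 4\mathbb{Z}_{(2)}$, where $\mathbb{Z}_{(2)}$ is the ring of rational numbers with odd denominator. Let $\alpha, \beta \in \mathbb{Q} \setminus \{0,1\}$. (1) If $\rho(\alpha) \neq \rho(\beta)$, then $T(\alpha,\beta) = \emptyset$. In particular, $T(2,3) = \emptyset$. (2) If $\alpha \equiv 3 \bmod 4$ and $\beta \equiv 1 \bmod 4$, then $T(\alpha,\beta)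 \subseteq \{\alpha^2, \beta\}$. (3) If $\alpha \equiv 2 \bmod 4$ and $\beta \equiv 0 \bmod 4$, then $T(\alpha,\beta) \subseteq \{\alpha(2-\alpha), \beta\}$. (4) If $v(\alpha) = -1$ and $v(\beta) \le -2$, then $T(\alpha,\beta) \subseteq \{\alpha^2/(2\alpha-1), \beta\}$, where for $\alpha = 1/2$ the undefined first element is omitted, i.e. $T(1/2,\beta) \subseteq \{\beta\}$. -/

import Mathlib

open scoped LinearAlgebra.Projectivization

/-- The Legendre curve `E_c : y² = x (x - 1) (x - c) = x³ - (1 + c) x² + c x` over `ℂ`. -/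
def legendreCurve (c : ℂ) : WeierstrassCurve ℂ where
  a₁ := 0
  a₂ := -(1 + c)
  a₃ := 0
  a₄ := c
  a₆ := 0

/-- The affine equation of `legendreCurve c` is indeed `y² = x (x - 1) (x - c)`. -/
theorem legendreCurve_equation_iff (c x y : ℂ) :
    (legendreCurve c).toAffine.Equation x y ↔ y ^ 2 = x * (x - 1) * (x - c) := by
  rw [WeierstrassCurve.Affine.equation_iff]
  simp only [legendreCurve]
  constructor <;> intro h <;> linear_combination h

/-- `torsionParams a = T(a)`: the set of all `c ∈ ℂ \ {0, 1}` such that a point with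
`x`-coordinate `a` on the elliptic curve `E_c` is a torsion point of the group `E_c(ℂ)`.
(The points with `x`-coordinate `a` are negatives of one another, so the choice of the point
is irrelevant.) -/
def torsionParams (a : ℂ) : Set ℂ :=
  {c | c ≠ 0 ∧ c ≠ 1 ∧
    ∃ (y : ℂ) (h : (legendreCurve c).toAffine.Nonsingular a y),
      IsOfFinAddOrder (WeierstrassCurve.Affine.Point.some a y h)}

/-- `torsionParams₂ a b = T(a, b) = T(a) ∩ T(b)`. -/
def torsionParams₂ (a b : ℂ) : Set ℂ := torsionParams a ∩ torsionParams b

/-- Numerator and denominator of a rational number do not both vanish modulo `2`. -/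
theorem reductionVec_ne_zero (q : ℚ) : (![(q.num : ZMod 2), (q.den : ZMod 2)]) ≠ 0 := by
  intro h
  have h0 : (q.num : ZMod 2) = 0 := congrFun h 0
  have h1 : (q.den : ZMod 2) = 0 := congrFun h 1
  have d0 : 2 ∣ q.num.natAbs := by
    have := (ZMod.intCast_zmod_eq_zero_iff_dvd q.num 2).1 h0
    omega
  have d1 : 2 ∣ q.den := (ZMod.natCast_eq_zero_iff q.den 2).1 h1
  have := Nat.dvd_gcd d0 d1
  rw [q.reduced] at this
  omega

/-- Reduction modulo `2` of rational numbers, `ρ : ℚ → ℙ¹(𝔽₂)`: write `q` in lowest terms as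
`m / n` and take the point `(m mod 2 : n mod 2)`. -/
def reductionMod2 (q : ℚ) : ℙ (ZMod 2) (Fin 2 → ZMod 2) :=
  Projectivization.mk (ZMod 2) ![(q.num : ZMod 2), (q.den : ZMod 2)] (reductionVec_ne_zero q)

/-- Congruence modulo `4` in the local ring `ℤ₍₂₎`: `a - b = 4 t` for a rational number `t` with
odd denominator. -/
def CongrMod4 (a b : ℚ) : Prop := ∃ t : ℚ, Odd t.den ∧ a - b = 4 * t

/-! Choose a valuation `v` on ℂ with `v 2 < 1`. A torsion point has only finitely many multiples, so
its `x`-coordinate has a finite orbit under doubling. The denominator 4x(x - 1)(x - c) of the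
doubling map makes large `x` larger still, hence finite orbits satisfy `v x ≤ max 1 (v c)`.
Finiteness also survives doubling and translation by 2-torsion, so the bound holds for those points
too. Applied to `x` and its double, the bound makes `c` reduce to 0, 1 or ∞ together with a rational
`x`; this separates different residues. For α ≡ 3 and β ≡ 1 mod 4: if c ≠ β, integrality of the
translate and the double of β forces c ≡ 1 mod 8. Then α² - c is divisible by 8, while 4α(α - 1)(α -
c) is only as small as 2⁴, so the double of α is a non-unit. Unless it is 0, that is c = α², its
translate c/x is not integral, a contradiction. The other congruence cases follow by x ↦ 1 - x and x
↦ 1/x. -/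

namespace Valuation

variable {K : Type*} [Field K] {Γ : Type*} [LinearOrderedCommGroupWithZero Γ] {v : Valuation K Γ}

theorem map_four_lt_one (h2 : v 2 < 1) : v 4 < 1 := by
  have : (4 : K) = 2 ^ 2 := by norm_num
  rw [this, map_pow]
  exact pow_lt_one₀ zero_le h2 two_ne_zero

theorem map_two_mul_lt_one (h2 : v 2 < 1) {a : K} (ha : v a ≤ 1) : v (2 * a) < 1 := by
  rw [map_mul]
  exact mul_lt_one_of_lt_of_le h2 ha

theorem map_one_add_two_mul (h2 : v 2 < 1) {a : K} (ha : v a ≤ 1) :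
    v (1 + 2 * a) = 1 :=
  v.map_one_add_of_lt (map_two_mul_lt_one h2 ha)

theorem map_intCast_le_one (n : ℤ) : v (n : K) ≤ 1 := by
  have hn : ∀ m : ℕ, v (m : K) ≤ 1 := fun m ↦ by
    induction m with
    | zero => simp
    | succ m ih => push_cast; exact v.map_add_le ih (by simp)
  obtain ⟨m, rfl | rfl⟩ := n.eq_nat_or_neg <;> simpa using hn m

theorem map_intCast_lt_one_of_even (h2 : v 2 < 1) {n : ℤ} (hn : Even n) :
    v (n : K) < 1 := by
  obtain ⟨k, rfl⟩ := even_iff_exists_two_mul.1 hn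
  push_cast
  exact map_two_mul_lt_one h2 (map_intCast_le_one k)

theorem map_intCast_eq_one_of_odd (h2 : v 2 < 1) {n : ℤ} (hn : Odd n) :
    v (n : K) = 1 := by
  obtain ⟨k, rfl⟩ := hn
  push_cast
  rw [add_comm]
  exact map_one_add_two_mul h2 (map_intCast_le_one k)

end Valuation

/-- The `x`-coordinate of the double of a point with `x`-coordinate `x` on
`y² = x (x - 1) (x - c)`. -/
def xDouble {K : Type*} [Field K] (c x : K) : K :=
  (x ^ 2 - c) ^ 2 / (4 * x * (x - 1) * (x - c))

/-- The forward orbit of `x` under `xDouble c` is contained in a finite set, where orbits stop at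
the `x`-coordinates `0`, `1`, `c` of the points of order two. -/
def HasFiniteXOrbit {K : Type*} [Field K] (c x : K) : Prop :=
  ∃ S : Set K, S.Finite ∧ x ∈ S ∧ ∀ s ∈ S, s ≠ 0 → s ≠ 1 → s ≠ c → xDouble c s ∈ S

/-! ### Symmetries of finite orbits. -/

namespace HasFiniteXOrbit

section Field

variable {K : Type*} [Field K] {c x : K}

theorem xDouble (h : HasFiniteXOrbit c x) (h0 : x ≠ 0) (h1 : x ≠ 1) (hc : x ≠ c) :
    HasFiniteXOrbit c (xDouble c x) := by
  obtain ⟨S, hS, hx, hd⟩ := h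
  exact ⟨S, hS, hd x hx h0 h1 hc, hd⟩

theorem of_xDouble (h : x ≠ 0 → x ≠ 1 → x ≠ c → HasFiniteXOrbit c (_root_.xDouble c x)) :
    HasFiniteXOrbit c x := by
  by_cases h' : x ≠ 0 ∧ x ≠ 1 ∧ x ≠ c
  · obtain ⟨S, hS, hx, hd⟩ := h h'.1 h'.2.1 h'.2.2
    refine ⟨insert x S, hS.insert x, Set.mem_insert _ _, ?_⟩
    rintro s (rfl | hs) s0 s1 sc
    · exact Set.mem_insert_of_mem _ hx
    · exact Set.mem_insert_of_mem _ (hd s hs s0 s1 sc)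
  · refine ⟨{x}, Set.finite_singleton x, rfl, ?_⟩
    rintro s rfl s0 s1 sc
    exact (h' ⟨s0, s1, sc⟩).elim

/-- Invariance under translation by the point `(0, 0)`. -/
theorem div_left (h : HasFiniteXOrbit c x) (hc : c ≠ 0) (hx : x ≠ 0) :
    HasFiniteXOrbit c (c / x) := by
  refine of_xDouble fun _ h1 h2 ↦ ?_
  have x1 : x ≠ 1 := by rintro rfl; simp at h2
  have xc : x ≠ c := by rintro rfl; simp [hx] at h1
  -- For T of order two, 2(P + T) = 2P: both orbits agree after one step.
  convert h.xDouble hx x1 xc using 1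
  have e1 : x - 1 ≠ 0 := sub_ne_zero.2 x1
  have e2 : x - c ≠ 0 := sub_ne_zero.2 xc
  have e3 : c / x - 1 = -(x - c) / x := by field_simp; ring
  have e4 : c / x - c = -(c * (x - 1)) / x := by field_simp; ring
  have e5 : (c / x) ^ 2 - c = -(c * (x ^ 2 - c)) / x ^ 2 := by field_simp; ring
  -- In characteristic 2 both doubles are 0 by the convention for division by zero.
  by_cases h4 : (4 : K) = 0
  · simp [_root_.xDouble, h4]
  rw [_root_.xDouble, _root_.xDouble, e3, e4, e5]
  field_simp

/-- Invariance under translation by the point `(1, 0)`. -/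
theorem sub_div_sub_one (h : HasFiniteXOrbit c x) (hc : c ≠ 1) (hx : x ≠ 1) :
    HasFiniteXOrbit c ((x - c) / (x - 1)) := by
  have e1 : x - 1 ≠ 0 := sub_ne_zero.2 hx
  have e0 : 1 - c ≠ 0 := sub_ne_zero.2 hc.symm
  refine of_xDouble fun h0 _ h2 ↦ ?_
  have xc : x ≠ c := by rintro rfl; simp at h0
  have x0 : x ≠ 0 := by rintro rfl; simp at h2
  convert h.xDouble x0 hx xc using 1
  have e2 : x - c ≠ 0 := sub_ne_zero.2 xc
  have e3 : (x - c) / (x - 1) - 1 = (1 - c) / (x - 1) := by field_simp; ring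
  have e4 : (x - c) / (x - 1) - c = (x * (1 - c)) / (x - 1) := by field_simp; ring
  have e5 : ((x - c) / (x - 1)) ^ 2 - c = ((1 - c) * (x ^ 2 - c)) / (x - 1) ^ 2 := by
    field_simp; ring
  by_cases h4 : (4 : K) = 0
  · simp [_root_.xDouble, h4]
  rw [_root_.xDouble, _root_.xDouble, e3, e4, e5]
  field_simp

/-- The map x ↦ 1 - x carries the curve to a quadratic twist of the one with parameter 1 - c, and
twisting does not affect doubling of `x`-coordinates. If 4 = 0, the junk value 0 of `xDouble` would
not be respected. -/
theorem one_sub (h4 : (4 : K) ≠ 0) (h : HasFiniteXOrbit c x) :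
    HasFiniteXOrbit (1 - c) (1 - x) := by
  obtain ⟨S, hS, hx, hd⟩ := h
  refine ⟨(1 - ·) '' S, hS.image _, ⟨x, hx, rfl⟩, ?_⟩
  rintro _ ⟨s, hs, rfl⟩ h0 h1 h2
  have s1 : s ≠ 1 := by rintro rfl; simp at h0
  have s0 : s ≠ 0 := by rintro rfl; simp at h1
  have sc : s ≠ c := by rintro rfl; simp at h2
  refine ⟨_, hd s hs s0 s1 sc, ?_⟩
  have e1 : s - 1 ≠ 0 := sub_ne_zero.2 s1
  have e2 : s - c ≠ 0 := sub_ne_zero.2 sc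
  have e3 : 1 - s ≠ 0 := sub_ne_zero.2 s1.symm
  have e4 : 1 - s - (1 - c) = -(s - c) := by ring
  have e5 : 1 - s - 1 = -s := by ring
  have e6 : 1 - s = -(s - 1) := by ring
  simp only [_root_.xDouble]
  rw [e4, e5, e6]
  field_simp
  ring

theorem inv (hc : c ≠ 0) (hx : x ≠ 0) (h : HasFiniteXOrbit c x) :
    HasFiniteXOrbit c⁻¹ x⁻¹ := by
  -- x⁻¹ is the translate c/x rescaled by 1/c; rescaling sends the roots 0, 1, c to 0, 1/c, 1.
  suffices H : ∀ z, HasFiniteXOrbit c z → HasFiniteXOrbit c⁻¹ (z / c) by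
    simpa [div_div_cancel_left' hc] using H _ (h.div_left hc hx)
  rintro z ⟨S, hS, hz, hd⟩
  refine ⟨(· / c) '' S, hS.image _, ⟨z, hz, rfl⟩, ?_⟩
  rintro _ ⟨s, hs, rfl⟩ h0 h1 h2
  have s0 : s ≠ 0 := by rintro rfl; simp at h0
  have sc : s ≠ c := by rintro rfl; simp [hc] at h1
  have s1 : s ≠ 1 := by rintro rfl; simp at h2
  refine ⟨_, hd s hs s0 s1 sc, ?_⟩
  have e1 : s - 1 ≠ 0 := sub_ne_zero.2 s1
  have e2 : s - c ≠ 0 := sub_ne_zero.2 sc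
  have e3 : s / c - 1 = (s - c) / c := by field_simp
  have e4 : s / c - c⁻¹ = (s - 1) / c := by field_simp
  have e5 : (s / c) ^ 2 - c⁻¹ = (s ^ 2 - c) / c ^ 2 := by field_simp
  by_cases h4 : (4 : K) = 0
  · simp [_root_.xDouble, h4]
  simp only [_root_.xDouble]
  rw [e3, e4, e5]
  field_simp

end Field

/-! ### Integrality constraints on the parameter. -/

section Valuation

variable {K : Type*} [Field K] [CharZero K] {Γ : Type*} [LinearOrderedCommGroupWithZero Γ]
  {v : Valuation K Γ} {c x : K}

theorem valuation_xDouble (h0 : x ≠ 0) (h1 : x ≠ 1) (hc : x ≠ c) :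
    v (x ^ 2 - c) ^ 2 = v (_root_.xDouble c x) * (v 4 * v x * v (x - 1) * v (x - c)) := by
  have e1 : x - 1 ≠ 0 := sub_ne_zero.2 h1
  have e2 : x - c ≠ 0 := sub_ne_zero.2 hc
  simp only [← map_pow, ← map_mul]
  rw [_root_.xDouble, div_mul_cancel₀]
  simp [h0, e1, e2]

/-- Points outside the disc of radius `max 1 (v c)` move away under doubling. -/
theorem valuation_le (h2 : v 2 < 1) (h : HasFiniteXOrbit c x) : v x ≤ max 1 (v c) := by
  obtain ⟨S, hS, hx, hd⟩ := h
  by_contra! hlt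
  -- At a point `s` of largest valuation, the double would have valuation v(s)/v(4) > v(s).
  obtain ⟨s, hs, hmax⟩ := hS.exists_maximalFor v S ⟨x, hx⟩
  have hsx : v x ≤ v s := by
    rcases le_total (v x) (v s) with h | h
    · exact h
    · exact hmax hx h
  obtain ⟨s1, sc⟩ := max_lt_iff.1 (hlt.trans_le hsx)
  have s0 : s ≠ 0 := by rintro rfl; simp at s1
  have sn1 : s ≠ 1 := by rintro rfl; simp at s1
  have snc : s ≠ c := by rintro rfl; simp at sc
  have hD := hd s hs s0 sn1 snc
  have hDs : v (_root_.xDouble c s) ≤ v s := by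
    rcases le_total (v (_root_.xDouble c s)) (v s) with h | h
    · exact h
    · exact hmax hD h
  have hpos : 0 < v s := zero_lt_one.trans s1
  have key := valuation_xDouble (v := v) s0 sn1 snc
  have a1 : v (s - 1) = v s := v.map_sub_eq_of_lt_left (by simpa using s1)
  have a2 : v (s - c) = v s := v.map_sub_eq_of_lt_left sc
  have a3 : v (s ^ 2 - c) = v s ^ 2 := by
    rw [v.map_sub_eq_of_lt_left, map_pow]
    rw [map_pow]
    exact sc.trans_le (le_self_pow₀ s1.le two_ne_zero)
  rw [a1, a2, a3] at key
  have : v s ^ 4 < v s ^ 4 := by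
    calc v s ^ 4 = (v s ^ 2) ^ 2 := by rw [← pow_mul]
      _ = v (_root_.xDouble c s) * v 4 * v s ^ 3 := by rw [key, pow_three]; ac_rfl
      _ ≤ v s * v 4 * v s ^ 3 := by gcongr
      _ = v 4 * v s ^ 4 := by rw [pow_succ' (v s) 3]; ac_rfl
      _ < v s ^ 4 := mul_lt_of_lt_one_left (pow_pos hpos 4) (Valuation.map_four_lt_one h2)
  exact this.false

/-- If `v c > 1`, the numerator of the double has valuation v(c)² and the denominator at most
v(4)v(c), so the double exceeds the bound v(c). -/
theorem valuation_param_le_one (h2 : v 2 < 1) (h : HasFiniteXOrbit c x) (h0 : x ≠ 0)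
    (h1 : x ≠ 1) (hx : v x ≤ 1) : v c ≤ 1 := by
  by_contra! hc
  have xc : x ≠ c := by rintro rfl; exact hc.not_ge hx
  have key := valuation_xDouble (v := v) h0 h1 xc
  have hD := (h.xDouble h0 h1 xc).valuation_le h2
  rw [max_eq_right hc.le] at hD
  have a1 : v (x - 1) ≤ 1 := v.map_sub_le hx (by simp)
  have a2 : v (x - c) = v c := v.map_sub_eq_of_lt_right (hx.trans_lt hc)
  have a3 : v (x ^ 2 - c) = v c := by
    refine v.map_sub_eq_of_lt_right (lt_of_le_of_lt ?_ hc)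
    rw [map_pow]
    exact pow_le_one₀ zero_le hx
  rw [a2, a3] at key
  have hpos : 0 < v c := zero_lt_one.trans hc
  have : v c ^ 2 < v c ^ 2 := by
    calc v c ^ 2 = v (_root_.xDouble c x) * (v 4 * v x * v (x - 1) * v c) := key
      _ ≤ v c * (v 4 * 1 * 1 * v c) := by gcongr
      _ = v 4 * v c ^ 2 := by rw [mul_one, mul_one, sq]; ac_rfl
      _ < v c ^ 2 := mul_lt_of_lt_one_left (pow_pos hpos 2) (Valuation.map_four_lt_one h2)
  exact this.false

/-- The double is integral and its denominator contains the factor 4, so the numerator is a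
non-unit: `c` reduces to x². -/
theorem valuation_sq_sub_lt_one (h2 : v 2 < 1) (h : HasFiniteXOrbit c x) (h0 : x ≠ 0)
    (h1 : x ≠ 1) (xc : x ≠ c) (hx : v x ≤ 1) : v (x ^ 2 - c) < 1 := by
  have hc := h.valuation_param_le_one h2 h0 h1 hx
  have key := valuation_xDouble (v := v) h0 h1 xc
  have hD := (h.xDouble h0 h1 xc).valuation_le h2
  rw [max_eq_left hc] at hD
  have a1 : v (x - 1) ≤ 1 := v.map_sub_le hx (by simp)
  have a2 : v (x - c) ≤ 1 := v.map_sub_le hx hc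
  refine lt_of_pow_lt_pow_left₀ 2 zero_le ?_
  rw [key, one_pow]
  calc _ ≤ 1 * (v 4 * 1 * 1 * 1) := by gcongr
    _ < 1 := by simpa using Valuation.map_four_lt_one h2

theorem valuation_param_lt_one (h2 : v 2 < 1) (h : HasFiniteXOrbit c x) (h0 : x ≠ 0)
    (hx : v x < 1) : v c < 1 := by
  rcases eq_or_ne x c with rfl | xc
  · exact hx
  have h1 : x ≠ 1 := by rintro rfl; simp at hx
  have := h.valuation_sq_sub_lt_one h2 h0 h1 xc hx.le
  rw [show c = x ^ 2 - (x ^ 2 - c) by ring]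
  refine v.map_sub_lt ?_ this
  rw [map_pow]
  exact pow_lt_one₀ zero_le hx two_ne_zero

theorem valuation_param_sub_one_lt_one (h2 : v 2 < 1) (h : HasFiniteXOrbit c x)
    (h1 : x ≠ 1) (hx : v (x - 1) < 1) : v (c - 1) < 1 := by
  have hC := (h.one_sub (by norm_num)).valuation_param_lt_one h2 (sub_ne_zero.2 h1.symm)
    (by rwa [v.map_sub_swap])
  rwa [v.map_sub_swap] at hC

theorem one_lt_valuation_param (h2 : v 2 < 1) (h : HasFiniteXOrbit c x) (hx : 1 < v x) :
    1 < v c := by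
  have := hx.trans_le (h.valuation_le h2)
  simpa using this

/-- If `x ≡ 1 mod 4`, then a parameter `c ≠ x` is congruent to `1` modulo `8`. -/
theorem exists_param_eq_one_add (h2 : v 2 < 1) {a : K} (ha : v a ≤ 1) (ha0 : a ≠ 0)
    (c1 : c ≠ 1) (h : HasFiniteXOrbit c (1 + 4 * a)) (hne : c ≠ 1 + 4 * a) :
    ∃ m, v m ≤ 1 ∧ c = 1 + 8 * m := by
  have hu : v (1 + 4 * a) = 1 := by
    rw [show 1 + 4 * a = 1 + 2 * (2 * a) by ring]
    exact Valuation.map_one_add_two_mul h2 (Valuation.map_two_mul_lt_one h2 ha).le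
  have x0 : 1 + 4 * a ≠ 0 := by intro e; rw [e] at hu; simp at hu
  have x1 : 1 + 4 * a ≠ 1 := by simpa using ha0
  have hc := h.valuation_param_le_one h2 x0 x1 hu.le
  -- `t` is the `x`-coordinate of the translate by (1, 0), hence integral.
  obtain ⟨t, ht⟩ : ∃ t, t = (1 + 4 * a - c) / (1 + 4 * a - 1) := ⟨_, rfl⟩
  have ht1 : v t ≤ 1 := by
    have := (h.sub_div_sub_one c1 x1).valuation_le h2
    rwa [max_eq_left hc, ← ht] at this
  have hct : 1 + 4 * a - c = 4 * a * t := by rw [ht]; field_simp; ring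
  have key := valuation_xDouble (v := v) x0 x1 hne.symm
  have hD := (h.xDouble x0 x1 hne.symm).valuation_le h2
  rw [max_eq_left hc] at hD
  -- Numerator and denominator of the double share the factor (4a)²; cancelling it shows that 2
  -- divides x + t.
  rw [show (1 + 4 * a) ^ 2 - c = 4 * a * (1 + 4 * a + t) by linear_combination hct, hct,
    show 1 + 4 * a - 1 = 4 * a by ring, map_mul, mul_pow, map_mul v (4 * a) t, hu] at key
  have hpos : 0 < v (4 * a) := by simpa [Valuation.pos_iff] using ha0
  have hsq : v (1 + 4 * a + t) ^ 2 ≤ v 2 ^ 2 := by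
    refine le_of_mul_le_mul_left ?_ (pow_pos hpos 2)
    rw [key]
    calc _ ≤ 1 * (v 4 * 1 * v (4 * a) * (v (4 * a) * 1)) := by gcongr
      _ = v (4 * a) ^ 2 * v 4 := by rw [one_mul, mul_one, mul_one, sq]; ac_rfl
      _ = v (4 * a) ^ 2 * v 2 ^ 2 := by rw [← map_pow v 2]; norm_num
  have hw := (pow_le_pow_iff_left₀ zero_le zero_le two_ne_zero).1 hsq
  have hw' : v ((1 + 4 * a + t) / 2) ≤ 1 := by
    rw [map_div₀]
    exact div_le_one_of_le₀ hw zero_le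
  -- From c = 1 + 4a(1 - t) and 1 - t = 2(1 + 2a) - (1 + 4a + t).
  refine ⟨a * (1 + 2 * a - (1 + 4 * a + t) / 2), ?_, ?_⟩
  · rw [map_mul]
    refine mul_le_one' ha (v.map_sub_le ?_ hw')
    exact (Valuation.map_one_add_two_mul h2 ha).le
  · linear_combination -hct

theorem param_eq_of_congr_three_of_congr_one (h2 : v 2 < 1) {s a : K} (hs : v s ≤ 1)
    (ha : v a ≤ 1) (ha0 : a ≠ 0) (c0 : c ≠ 0) (c1 : c ≠ 1)
    (h3 : HasFiniteXOrbit c (3 + 4 * s)) (h1 : HasFiniteXOrbit c (1 + 4 * a)) :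
    c = (3 + 4 * s) ^ 2 ∨ c = 1 + 4 * a := by
  by_contra! hne
  obtain ⟨m, hm, hcm⟩ := h1.exists_param_eq_one_add h2 ha ha0 c1 hne.2
  have v2 : ∀ {a b : K}, v a ≤ 1 → v b ≤ 1 → v (a + b) ≤ 1 := fun h h' ↦ v.map_add_le h h'
  have v8 : v (8 * m) < 1 := by
    rw [show 8 * m = 2 * (2 * (2 * m)) by ring]
    exact Valuation.map_two_mul_lt_one h2 (Valuation.map_two_mul_lt_one h2
      (Valuation.map_two_mul_lt_one h2 hm).le).le
  have hvc : v c = 1 := by rw [hcm]; exact v.map_one_add_of_lt v8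
  have hu : v (3 + 4 * s) = 1 := by
    rw [show 3 + 4 * s = 1 + 2 * (1 + 2 * s) by ring]
    exact Valuation.map_one_add_two_mul h2 (Valuation.map_one_add_two_mul h2 hs).le
  have hu1 : v (3 + 4 * s - 1) = v 2 := by
    rw [show 3 + 4 * s - 1 = 2 * (1 + 2 * s) by ring, map_mul,
      Valuation.map_one_add_two_mul h2 hs, mul_one]
  have huc : v (3 + 4 * s - c) = v 2 := by
    rw [hcm, show 3 + 4 * s - (1 + 8 * m) = 2 * (1 + 2 * (s - 2 * m)) by ring, map_mul,
      Valuation.map_one_add_two_mul h2 (v.map_sub_le hs (Valuation.map_two_mul_lt_one h2 hm).le), mul_one]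
  have p2 : v 2 ≠ 0 := by simp
  have x0 : 3 + 4 * s ≠ 0 := by rintro e; simp [e] at hu
  have x1 : 3 + 4 * s ≠ 1 := by rintro e; exact p2 (by simpa [e] using hu1.symm)
  have xc : 3 + 4 * s ≠ c := by rintro e; exact p2 (by simpa [e] using huc.symm)
  have hdiff : v ((3 + 4 * s) ^ 2 - c) ≤ v 2 ^ 3 := by
    rw [hcm, show (3 + 4 * s) ^ 2 - (1 + 8 * m) = 2 ^ 3 * ((1 + 2 * s) * (1 + s) - m) by ring,
      map_mul, map_pow]
    refine mul_le_of_le_one_right' (v.map_sub_le ?_ hm)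
    rw [map_mul, Valuation.map_one_add_two_mul h2 hs, one_mul]
    exact v2 (by simp) hs
  have key := valuation_xDouble (v := v) x0 x1 xc
  have hD := h3.xDouble x0 x1 xc
  -- The double is (0, 0) exactly when c = (3 + 4s)², the excluded exception.
  have hD0 : _root_.xDouble c (3 + 4 * s) ≠ 0 := by
    intro e
    rw [e, map_zero, zero_mul] at key
    simp [sub_eq_zero, hne.1.symm] at key
  -- Since c is a unit, integrality of the translate c/x of the double gives the lower bound v(x) ≥
  -- 1, whereas the formula for the double gives v(x) ≤ v(2)².
  have hD1 := (hD.div_left c0 hD0).valuation_le h2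
  rw [hvc, max_self, map_div₀, hvc, div_le_one₀ (by simpa [Valuation.pos_iff] using hD0)] at hD1
  have h4 : v 4 = v 2 ^ 2 := by rw [← map_pow]; norm_num
  rw [hu, hu1, huc, h4, mul_one] at key
  have p4 : 0 < v 2 ^ 4 := by simp [Valuation.pos_iff]
  have : v 2 ^ 4 < v 2 ^ 4 := by
    calc v 2 ^ 4 = 1 * (v 2 ^ 2 * v 2 * v 2) := by rw [one_mul, ← pow_succ, ← pow_succ]
      _ ≤ _ := mul_le_mul_left hD1 _
      _ = v ((3 + 4 * s) ^ 2 - c) ^ 2 := key.symm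
      _ ≤ (v 2 ^ 3) ^ 2 := by gcongr
      _ = v 2 ^ 2 * v 2 ^ 4 := by rw [← pow_mul, ← pow_add]
      _ < v 2 ^ 4 := mul_lt_of_lt_one_left p4 (pow_lt_one₀ zero_le h2 two_ne_zero)
  exact this.false

theorem param_eq_of_congr_two_of_congr_zero (h2 : v 2 < 1) {s b : K} (hs : v s ≤ 1)
    (hb : v b ≤ 1) (hb0 : b ≠ 0) (c0 : c ≠ 0) (c1 : c ≠ 1)
    (h3 : HasFiniteXOrbit c (2 + 4 * s)) (h1 : HasFiniteXOrbit c (4 * b)) :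
    c = (2 + 4 * s) * (2 - (2 + 4 * s)) ∨ c = 4 * b := by
  have h3' := h3.one_sub (by norm_num)
  have h1' := h1.one_sub (by norm_num)
  rw [show 1 - (2 + 4 * s) = 3 + 4 * (-s - 1) by ring] at h3'
  rw [show 1 - 4 * b = 1 + 4 * -b by ring] at h1'
  refine (param_eq_of_congr_three_of_congr_one h2 (v.map_sub_le (by simpa using hs) (by simp))
    (by simpa using hb) (neg_ne_zero.2 hb0) (sub_ne_zero.2 c1.symm) (by simpa using c0)
    h3' h1').imp (fun e ↦ ?_) (fun e ↦ ?_)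
  · linear_combination -e
  · linear_combination -e

end Valuation

end HasFiniteXOrbit

/-! ### Rational points and their reduction modulo 2. -/

section Rational

variable {K : Type*} [Field K] [CharZero K] {Γ : Type*} [LinearOrderedCommGroupWithZero Γ]
  {v : Valuation K Γ}

theorem Rat.cast_mul_intCast_den (q : ℚ) : (q : K) * ((q.den : ℤ) : K) = (q.num : K) := by
  exact_mod_cast congrArg (Rat.cast : ℚ → K) (Rat.mul_den_eq_num q)

theorem Valuation.map_ratCast_le_one (h2 : v 2 < 1) {q : ℚ} (hq : Odd q.den) :
    v (q : K) ≤ 1 := by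
  have h := congrArg v (Rat.cast_mul_intCast_den (K := K) q)
  rw [map_mul, map_intCast_eq_one_of_odd h2 (by exact_mod_cast hq), mul_one] at h
  rw [h]
  exact map_intCast_le_one _

theorem Rat.odd_num_of_even_den {q : ℚ} (hq : Even q.den) : Odd q.num := by
  rw [← Int.not_even_iff_odd]
  intro hn
  have h := Nat.dvd_gcd (Int.natAbs_dvd_natAbs.2 hn.two_dvd) hq.two_dvd
  rw [q.reduced] at h
  norm_num at h

/-- The cases are the three points 0, 1, ∞ of ℙ¹(𝔽₂). As `v c` tells them apart, a common parameter
forces a common reduction. -/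
theorem HasFiniteXOrbit.valuation_param_of_rat (h2 : v 2 < 1) {c : K} {q : ℚ} (q0 : q ≠ 0)
    (q1 : q ≠ 1) (h : HasFiniteXOrbit c (q : K)) :
    (Even q.num ∧ Odd q.den ∧ v c < 1) ∨ (Odd q.num ∧ Odd q.den ∧ v c = 1) ∨
      (Odd q.num ∧ Even q.den ∧ 1 < v c) := by
  have hq := congrArg v (Rat.cast_mul_intCast_den (K := K) q)
  rw [map_mul] at hq
  rcases Nat.even_or_odd q.den with hd | hd
  · have hn := Rat.odd_num_of_even_den hd
    refine Or.inr (Or.inr ⟨hn, hd, h.one_lt_valuation_param h2 ?_⟩)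
    by_contra! hle
    rw [Valuation.map_intCast_eq_one_of_odd h2 hn] at hq
    have hd1 : v ((q.den : ℤ) : K) < 1 :=
      Valuation.map_intCast_lt_one_of_even h2 (by exact_mod_cast hd)
    exact (mul_lt_one_of_nonneg_of_lt_one_right hle zero_le hd1).ne hq
  have hd1 : v ((q.den : ℤ) : K) = 1 :=
    Valuation.map_intCast_eq_one_of_odd h2 (by exact_mod_cast hd)
  rcases Int.even_or_odd q.num with hn | hn
  · rw [hd1, mul_one] at hq
    refine Or.inl ⟨hn, hd, h.valuation_param_lt_one h2 (by exact_mod_cast q0) ?_⟩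
    rw [hq]
    exact Valuation.map_intCast_lt_one_of_even h2 hn
  · refine Or.inr (Or.inl ⟨hn, hd, ?_⟩)
    have hsub : v ((q : K) - 1) < 1 := by
      have e : ((q : K) - 1) * ((q.den : ℤ) : K) = ((q.num - q.den : ℤ) : K) := by
        rw [sub_mul, Rat.cast_mul_intCast_den]; push_cast; ring
      have := congrArg v e
      rw [map_mul, hd1, mul_one] at this
      rw [this]
      exact Valuation.map_intCast_lt_one_of_even h2 (hn.sub_odd (by exact_mod_cast hd))
    have := h.valuation_param_sub_one_lt_one h2 (by exact_mod_cast q1) hsub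
    rw [show c = 1 + (c - 1) by ring]
    exact v.map_one_add_of_lt this

end Rational

theorem reductionMod2_eq_of_even_iff {p q : ℚ} (hn : Even p.num ↔ Even q.num)
    (hd : Even p.den ↔ Even q.den) : reductionMod2 p = reductionMod2 q := by
  have e1 : (p.num : ZMod 2) = q.num := by
    rw [ZMod.intCast_eq_intCast_iff_dvd_sub]
    rw [Int.even_iff, Int.even_iff] at hn
    omega
  have e2 : (p.den : ZMod 2) = q.den := by
    rw [ZMod.natCast_eq_natCast_iff']
    rw [Nat.even_iff, Nat.even_iff] at hd
    omega
  simp only [reductionMod2, e1, e2]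

theorem Rat.odd_den_of_padicValRat_nonneg {q : ℚ} (h : 0 ≤ padicValRat 2 q) : Odd q.den := by
  by_contra hd
  rw [Nat.not_odd_iff_even] at hd
  have hn := Rat.odd_num_of_even_den hd
  have hn0 : padicValInt 2 q.num = 0 :=
    padicValInt.eq_zero_of_not_dvd (by rw [Nat.cast_ofNat, ← even_iff_two_dvd]; simpa using hn)
  have hd1 := one_le_padicValNat_of_dvd q.den_nz hd.two_dvd
  rw [padicValRat, hn0] at h
  omega

theorem congrMod4_inv_zero_of_padicValRat_le {q : ℚ} (h0 : q ≠ 0) (h : padicValRat 2 q ≤ -2) :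
    CongrMod4 q⁻¹ 0 := by
  refine ⟨q⁻¹ / 4, Rat.odd_den_of_padicValRat_nonneg ?_, by ring⟩
  rw [padicValRat.div (by simpa using h0) (by norm_num), padicValRat.inv,
    show (4 : ℚ) = ((2 : ℕ) : ℚ) ^ 2 by norm_num, padicValRat.pow ((2 : ℕ) : ℚ), padicValRat.self (by norm_num)]
  push_cast
  omega

theorem congrMod4_inv_two_of_padicValRat_eq {q : ℚ} (h : padicValRat 2 q = -1) :
    CongrMod4 q⁻¹ 2 := by
  have h0 : q ≠ 0 := by rintro rfl; simp at h
  have hr : padicValRat 2 (2 * q) = 0 := by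
    rw [padicValRat.mul (by norm_num) h0, h]
    have := padicValRat.self (p := 2) (by norm_num)
    push_cast at this
    rw [this]; norm_num
  -- `r` is a 2-adic unit, so r - 1 is even and q⁻¹ - 2 = 2(r - 1) is divisible by 4.
  obtain ⟨r, hr'⟩ : ∃ r, r = (2 * q)⁻¹ := ⟨_, rfl⟩
  have hd : Odd r.den := Rat.odd_den_of_padicValRat_nonneg (by rw [hr', padicValRat.inv, hr]; simp)
  have hn : Odd r.num := by
    have hd' : Odd r⁻¹.den :=
      Rat.odd_den_of_padicValRat_nonneg (by rw [hr', inv_inv, hr])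
    have r0 : r ≠ 0 := by rw [hr']; simpa using h0
    rw [Rat.den_inv_of_ne_zero r0] at hd'
    exact Int.natAbs_odd.1 hd'
  obtain ⟨k, hk⟩ : Even (r.num - r.den) := hn.sub_odd (by exact_mod_cast hd)
  refine ⟨(k : ℚ) / r.den, ?_, ?_⟩
  · refine Odd.of_dvd_nat hd ?_
    have := Rat.den_dvd k r.den
    rw [Rat.divInt_eq_div] at this
    exact_mod_cast this
  · have e : q⁻¹ = 2 * r := by rw [hr']; field_simp
    have hk' : (r.num : ℚ) - r.den = k + k := by exact_mod_cast congrArg (Int.cast : ℤ → ℚ) hk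
    have hdn : (r.den : ℚ) ≠ 0 := by exact_mod_cast r.den_nz
    have hmul := Rat.mul_den_eq_num r
    rw [e]
    field_simp
    linear_combination 2 * hmul + 2 * hk'

/-! ### From torsion points over ℂ to finite orbits. -/

/-- The ideal (2) of ℤ is proper, so some valuation ring of `K` has 2 as a non-unit. Its value group
is not controlled, which is why the bounds above hold for arbitrary `Γ`. -/
theorem exists_valuation_two_lt_one (K : Type*) [Field K] [CharZero K] :
    ∃ A : ValuationSubring K, A.valuation 2 < 1 := by
  let R : Subring K := (Int.castRingHom K).range
  obtain ⟨A, -, hA⟩ := Ideal.image_subset_nonunits_valuationSubring (A := R)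
    (Ideal.span {(2 : R)}) (by
      rw [Ne, Ideal.span_singleton_eq_top]
      rintro h
      obtain ⟨⟨_, n, rfl⟩, hn⟩ := isUnit_iff_exists_inv.1 h
      have : (2 : K) * n = 1 := congrArg Subtype.val hn
      have : (2 * n : ℤ) = 1 := by exact_mod_cast this
      omega)
  refine ⟨A, A.mem_nonunits_iff.1 (hA ⟨2, Ideal.subset_span rfl, rfl⟩)⟩

/-- The finite set consists of the `x`-coordinates of the affine multiples of the torsion point. -/
theorem hasFiniteXOrbit_of_mem_torsionParams {a c : ℂ} (h : c ∈ torsionParams a) :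
    HasFiniteXOrbit c a := by
  obtain ⟨-, -, y, hy, hP⟩ := h
  let W := (legendreCurve c).toAffine
  let P : W.Point := .some a y hy
  refine ⟨{x | ∃ y, ∃ h : W.Nonsingular x y, WeierstrassCurve.Affine.Point.some x y h ∈
    AddSubgroup.zmultiples P}, ?_, ⟨y, hy, AddSubgroup.mem_zmultiples P⟩, ?_⟩
  -- The value at infinity is arbitrary; only a finite set containing all the coordinates is needed.
  · let f : W.Point → ℂ := fun Q ↦ match Q with
      | .zero => 0
      | .some x _ _ => x
    have hfin : (AddSubgroup.zmultiples P : Set W.Point).Finite := hP.finite_zmultiples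
    refine (hfin.image f).subset ?_
    rintro x ⟨y, h, hx⟩
    exact ⟨_, hx, rfl⟩
  · rintro x ⟨y, h, hx⟩ h0 h1 hc
    have heq := (legendreCurve_equation_iff c x y).1 h.1
    have y0 : y ≠ 0 := by
      rintro rfl
      simp [h0, sub_ne_zero.2 h1, sub_ne_zero.2 hc] at heq
    have hneg : W.negY x y = -y := by
      simp [W, WeierstrassCurve.Affine.negY, legendreCurve]
    have hy : y ≠ W.negY x y := by
      rw [hneg]
      exact fun e ↦ y0 (self_eq_neg.1 e)
    have hadd := add_mem hx hx
    rw [WeierstrassCurve.Affine.Point.add_self_of_Y_ne hy] at hadd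
    have hx' : xDouble c x = W.addX x x (W.slope x x y y) := by
      have e1 : x - 1 ≠ 0 := sub_ne_zero.2 h1
      have e2 : x - c ≠ 0 := sub_ne_zero.2 hc
      rw [WeierstrassCurve.Affine.slope_of_Y_ne rfl hy, hneg, WeierstrassCurve.Affine.addX]
      simp only [W, legendreCurve, zero_mul, sub_zero, add_zero, sub_neg_eq_add]
      rw [← two_mul y, div_pow, mul_pow 2 y, heq, xDouble]
      field_simp
      ring
    rw [hx']
    exact ⟨_, _, hadd⟩

theorem corollaryC :
    (∀ α β : ℚ, α ≠ 0 → α ≠ 1 → β ≠ 0 → β ≠ 1 →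
      (reductionMod2 α ≠ reductionMod2 β → torsionParams₂ (α : ℂ) (β : ℂ) = ∅) ∧
      (CongrMod4 α 3 → CongrMod4 β 1 →
        torsionParams₂ (α : ℂ) (β : ℂ) ⊆ {(α : ℂ) ^ 2, (β : ℂ)}) ∧
      (CongrMod4 α 2 → CongrMod4 β 0 →
        torsionParams₂ (α : ℂ) (β : ℂ) ⊆ {(α : ℂ) * (2 - (α : ℂ)), (β : ℂ)}) ∧
      (padicValRat 2 α = -1 → padicValRat 2 β ≤ -2 →
        torsionParams₂ (α : ℂ) (β : ℂ) ⊆ {(α : ℂ) ^ 2 / (2 * (α : ℂ) - 1), (β : ℂ)} ∧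
        (α = 1 / 2 → torsionParams₂ (α : ℂ) (β : ℂ) ⊆ {(β : ℂ)}))) ∧
    torsionParams₂ 2 3 = ∅ := by
  obtain ⟨A, h2⟩ := exists_valuation_two_lt_one ℂ
  have hempty : ∀ α β : ℚ, α ≠ 0 → α ≠ 1 → β ≠ 0 → β ≠ 1 → reductionMod2 α ≠ reductionMod2 β →
      torsionParams₂ (α : ℂ) (β : ℂ) = ∅ := by
    intro α β α0 α1 β0 β1 hne
    refine Set.eq_empty_of_forall_notMem fun c ⟨hα, hβ⟩ ↦ hne ?_
    have Hα := (hasFiniteXOrbit_of_mem_torsionParams hα).valuation_param_of_rat h2 α0 α1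
    have Hβ := (hasFiniteXOrbit_of_mem_torsionParams hβ).valuation_param_of_rat h2 β0 β1
    rcases Hα with ⟨a1, a2, a3⟩ | ⟨a1, a2, a3⟩ | ⟨a1, a2, a3⟩ <;>
    rcases Hβ with ⟨b1, b2, b3⟩ | ⟨b1, b2, b3⟩ | ⟨b1, b2, b3⟩ <;>
    exact reductionMod2_eq_of_even_iff (by grind) (by grind)
  refine ⟨fun α β α0 α1 β0 β1 ↦ ⟨hempty α β α0 α1 β0 β1, ?_, ?_, ?_⟩, ?_⟩
  · rintro ⟨s, hs, es⟩ ⟨t, ht, et⟩ c ⟨hα, hβ⟩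
    have Hα := hasFiniteXOrbit_of_mem_torsionParams hα
    have Hβ := hasFiniteXOrbit_of_mem_torsionParams hβ
    obtain rfl : α = 3 + 4 * s := by linarith
    obtain rfl : β = 1 + 4 * t := by linarith
    have t0 : t ≠ 0 := by rintro rfl; simp at β1
    push_cast at Hα Hβ ⊢
    exact Hα.param_eq_of_congr_three_of_congr_one h2 (Valuation.map_ratCast_le_one h2 hs)
      (Valuation.map_ratCast_le_one h2 ht) (by exact_mod_cast t0) hα.1 hα.2.1 Hβ
  · rintro ⟨s, hs, es⟩ ⟨t, ht, et⟩ c ⟨hα, hβ⟩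
    have Hα := hasFiniteXOrbit_of_mem_torsionParams hα
    have Hβ := hasFiniteXOrbit_of_mem_torsionParams hβ
    obtain rfl : α = 2 + 4 * s := by linarith
    obtain rfl : β = 4 * t := by linarith
    have t0 : t ≠ 0 := by rintro rfl; simp at β0
    push_cast at Hα Hβ ⊢
    exact Hα.param_eq_of_congr_two_of_congr_zero h2 (Valuation.map_ratCast_le_one h2 hs)
      (Valuation.map_ratCast_le_one h2 ht) (by exact_mod_cast t0) hα.1 hα.2.1 Hβ
  · intro hvα hvβ
    have hsub : torsionParams₂ (α : ℂ) (β : ℂ) ⊆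
        {(α : ℂ) ^ 2 / (2 * (α : ℂ) - 1), (β : ℂ)} := by
      obtain ⟨s, hs, es⟩ := congrMod4_inv_two_of_padicValRat_eq hvα
      obtain ⟨t, ht, et⟩ := congrMod4_inv_zero_of_padicValRat_le β0 hvβ
      rintro c ⟨hα, hβ⟩
      have α0' : (α : ℂ) ≠ 0 := by exact_mod_cast α0
      have β0' : (β : ℂ) ≠ 0 := by exact_mod_cast β0
      have Hα := (hasFiniteXOrbit_of_mem_torsionParams hα).inv hα.1 α0'
      have Hβ := (hasFiniteXOrbit_of_mem_torsionParams hβ).inv hα.1 β0'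
      have es' : (α : ℂ)⁻¹ = 2 + 4 * s := by
        exact_mod_cast congrArg (Rat.cast : ℚ → ℂ) (show α⁻¹ = 2 + 4 * s by linarith)
      have et' : (β : ℂ)⁻¹ = 4 * t := by
        exact_mod_cast congrArg (Rat.cast : ℚ → ℂ) (show β⁻¹ = 4 * t by linarith)
      have t0 : (t : ℂ) ≠ 0 := by intro e; simp [e, β0] at et'
      rw [es'] at Hα
      rw [et'] at Hβ
      have := Hα.param_eq_of_congr_two_of_congr_zero h2 (Valuation.map_ratCast_le_one h2 hs)
        (Valuation.map_ratCast_le_one h2 ht) t0 (inv_ne_zero hα.1) (by simpa using hα.2.1) Hβ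
      rw [← es', ← et', inv_inj] at this
      -- Inverting c⁻¹ = α⁻¹(2 - α⁻¹) gives α²/(2α - 1).
      refine this.imp_left fun e ↦ ?_
      rw [← inv_inj, e, inv_div]
      field_simp
    refine ⟨hsub, ?_⟩
    rintro rfl c hc
    -- For α = 1/2 the quotient has denominator 0 and so equals 0, which is not an allowed
    -- parameter.
    refine (hsub hc).resolve_left fun e ↦ hc.1.1 ?_
    rw [e]
    norm_num
  · have h := hempty 2 3 (by norm_num) (by norm_num) (by norm_num) (by norm_num) ?_
    · simpa using h
    · intro h
      rw [reductionMod2, reductionMod2, Projectivization.mk_eq_mk_iff'] at h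
      obtain ⟨a, ha⟩ := h
      have h0 := congrFun ha 0
      have h1 := congrFun ha 1
      revert h0 h1
      revert a
      decide
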